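/- Let $\mathbb{C}_0=\{s\in\mathbb{C}: \operatorname{Re} s>0\}$, and let $\mathcal{A}^+$ be the Wiener–Dirichlet algebra, i.e. the algebra (under pointwise operations) of all functions $f:\mathbb{C}_0\to\mathbb{C}$ of the form $f(s)=\sum_{n=1}^\infty a_n n^{-s}$ with $\sum_{n=1}^\infty |a_n|<\infty$. Let $\varphi:\mathbb{C}_0\to\mathbb{C}_0$ be analytic. Then the composition operator $C_\varphi: f\mapsto f\circ\varphi$ maps $\mathcal{A}^+$ into itself and is an automorphism of the algebra $\mathcal{A}^+$ if and only if $\varphi$ is a vertical translation, that is, there is a real number $\tau$ such that $\varphi(s)=s+i\tau$ for all $s\in\mathbb{C}_0$. -/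

import Mathlib

/-- The open right half-plane `{s : 0 < Re s}`. -/
def rightHalfPlane : Set ℂ := {s | 0 < s.re}

/-- `f` is the sum, on the open right half-plane, of an absolutely convergent Dirichlet series
`∑_{n ≥ 1} a n * n ^ (-s)` with `∑ |a n| < ∞`. In Mathlib's `LSeries` the term of index `0` is `0`,
so that the value `a 0` plays no role. -/
def IsWienerDirichlet (f : rightHalfPlane → ℂ) : Prop :=
  ∃ a : ℕ → ℂ, Summable (fun n => ‖a n‖) ∧ ∀ s : rightHalfPlane, f s = LSeries a (s : ℂ)

theorem wienerDirichlet_lseriesSummable {a : ℕ → ℂ} (ha : Summable (fun n => ‖a n‖))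
    {s : ℂ} (hs : 0 ≤ s.re) : LSeriesSummable a s := by
  refine Summable.of_norm_bounded ha fun n => ?_
  rcases eq_or_ne n 0 with rfl | hn
  · simp
  · rw [LSeries.norm_term_eq, if_neg hn]
    exact div_le_self (norm_nonneg _)
      (Real.one_le_rpow (by exact_mod_cast Nat.one_le_iff_ne_zero.mpr hn) hs)

theorem IsWienerDirichlet.const (c : ℂ) : IsWienerDirichlet fun _ => c := by
  refine ⟨c • LSeries.delta, ?_, fun s => ?_⟩
  · refine summable_of_ne_finset_zero (s := {1}) fun n hn => ?_
    have : n ≠ 1 := by simpa using hn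
    simp [LSeries.delta, this]
  · rw [LSeries_smul, LSeries_delta]
    simp

theorem IsWienerDirichlet.add {f g : rightHalfPlane → ℂ} (hf : IsWienerDirichlet f)
    (hg : IsWienerDirichlet g) : IsWienerDirichlet (f + g) := by
  obtain ⟨a, ha, hfa⟩ := hf
  obtain ⟨b, hb, hgb⟩ := hg
  refine ⟨a + b, (ha.add hb).of_nonneg_of_le (fun _ => norm_nonneg _)
    (fun n => norm_add_le (a n) (b n)), fun s => ?_⟩
  have hs : 0 ≤ (s : ℂ).re := le_of_lt s.2
  rw [LSeries_add (wienerDirichlet_lseriesSummable ha hs) (wienerDirichlet_lseriesSummable hb hs),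
    Pi.add_apply, hfa, hgb]

theorem IsWienerDirichlet.mul {f g : rightHalfPlane → ℂ} (hf : IsWienerDirichlet f)
    (hg : IsWienerDirichlet g) : IsWienerDirichlet (f * g) := by
  obtain ⟨a, ha, hfa⟩ := hf
  obtain ⟨b, hb, hgb⟩ := hg
  refine ⟨LSeries.convolution a b, ?_, fun s => ?_⟩
  · have h := ((wienerDirichlet_lseriesSummable ha (s := 0) (by simp)).convolution
      (wienerDirichlet_lseriesSummable hb (s := 0) (by simp))).norm
    refine h.congr fun n => ?_
    rcases eq_or_ne n 0 with rfl | hn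
    · simp [LSeries.convolution_map_zero]
    · simp [LSeries.term_of_ne_zero hn]
  · have hs : 0 ≤ (s : ℂ).re := le_of_lt s.2
    rw [LSeries_convolution' (wienerDirichlet_lseriesSummable ha hs)
      (wienerDirichlet_lseriesSummable hb hs), Pi.mul_apply, hfa, hgb]

/-- The Wiener–Dirichlet algebra `𝒜⁺`, as an algebra of functions on the open right half-plane
(with pointwise operations). -/
def wienerDirichletAlgebra : Subalgebra ℂ (rightHalfPlane → ℂ) where
  carrier := {f | IsWienerDirichlet f}
  mul_mem' := IsWienerDirichlet.mul
  add_mem' := IsWienerDirichlet.add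
  algebraMap_mem' := IsWienerDirichlet.const

/-- The composition operator `C_φ : f ↦ f ∘ φ` with symbol `φ : ℂ₀ → ℂ₀` maps `𝒜⁺` into itself and
is an automorphism of the algebra `𝒜⁺`. -/
def CompositionIsAutomorphism (φ : rightHalfPlane → rightHalfPlane) : Prop :=
  ∃ T : wienerDirichletAlgebra ≃ₐ[ℂ] wienerDirichletAlgebra,
    ∀ f : wienerDirichletAlgebra, (T f : rightHalfPlane → ℂ) = (f : rightHalfPlane → ℂ) ∘ φ

/-! A vertical translation multiplies `a n` by the unimodular number `n ^ (-iτ)`, so it acts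
bijectively on the algebra.

Conversely, let `G`, `H` be the preimages of `2 ^ (-s)`, `3 ^ (-s)` under the automorphism, so that
`G ∘ φ = 2 ^ (-s)` and `H ∘ φ = 3 ^ (-s)`. Irrationality of `log 3 / log 2` keeps `G` free of zeros
(`ne_zero_of_comp_eq_cpow_neg`), and a spectral argument gives `|G| ≤ 1`. Hence `ψ = -log G / log
2`, with a suitable branch, is a holomorphic inverse of `φ` on the half-plane
(`exists_inverse_of_comp_eq_cpow_neg`).

Now `2 ^ (-φ)` and `2 ^ (-ψ)` are both Wiener–Dirichlet series. Invertibility forces their constant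
terms to vanish, and Phragmén–Lindelöf then gives `Re φ(s) ≥ Re s` and `Re ψ(s) ≥ Re s`
(`re_le_re_of_leftInverse`). So `φ` preserves real parts, and `φ(s) - s` is an imaginary constant by
the open mapping theorem. -/

theorem isOpen_rightHalfPlane : IsOpen rightHalfPlane :=
  isOpen_lt continuous_const Complex.continuous_re

theorem convex_rightHalfPlane : Convex ℝ rightHalfPlane := convex_halfSpace_re_gt 0

theorem isPreconnected_rightHalfPlane : IsPreconnected rightHalfPlane :=
  convex_rightHalfPlane.isPreconnected

theorem one_mem_rightHalfPlane : (1 : ℂ) ∈ rightHalfPlane := by simp [rightHalfPlane]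

theorem ofReal_mem_rightHalfPlane {x : ℝ} (hx : 0 < x) : (x : ℂ) ∈ rightHalfPlane := by
  simpa [rightHalfPlane] using hx

/-! ### Absolutely convergent Dirichlet series on the half-plane. -/

section WienerDirichletSeries

variable {a : ℕ → ℂ}

theorem abscissaOfAbsConv_le_zero_of_summable_norm (ha : Summable fun n => ‖a n‖) :
    LSeries.abscissaOfAbsConv a ≤ 0 := by
  simpa using (wienerDirichlet_lseriesSummable ha (s := 0) le_rfl).abscissaOfAbsConv_le

theorem abscissaOfAbsConv_lt_top_of_summable_norm (ha : Summable fun n => ‖a n‖) :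
    LSeries.abscissaOfAbsConv a < ⊤ :=
  (abscissaOfAbsConv_le_zero_of_summable_norm ha).trans_lt EReal.zero_lt_top

theorem analyticOnNhd_LSeries_rightHalfPlane (ha : Summable fun n => ‖a n‖) :
    AnalyticOnNhd ℂ (LSeries a) rightHalfPlane :=
  (LSeries_analyticOnNhd a).mono fun s hs =>
    (abscissaOfAbsConv_le_zero_of_summable_norm ha).trans_lt (by exact_mod_cast hs)

theorem norm_LSeries_term_le {s : ℂ} (hs : 0 ≤ s.re) (n : ℕ) :
    ‖LSeries.term a s n‖ ≤ ‖a n‖ := by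
  rcases eq_or_ne n 0 with rfl | hn
  · simp
  · rw [LSeries.norm_term_eq, if_neg hn]
    exact div_le_self (norm_nonneg _)
      (Real.one_le_rpow (by exact_mod_cast Nat.one_le_iff_ne_zero.mpr hn) hs)

theorem continuousOn_LSeries_closedHalfPlane (ha : Summable fun n => ‖a n‖) :
    ContinuousOn (LSeries a) {s : ℂ | 0 ≤ s.re} := by
  refine continuousOn_tsum (fun n => ?_) ha fun n s hs => norm_LSeries_term_le hs n
  rcases eq_or_ne n 0 with rfl | hn
  · simpa using continuousOn_const
  · have h : (n : ℂ) ≠ 0 := by exact_mod_cast hn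
    simp only [LSeries.term_of_ne_zero hn]
    exact (Continuous.div continuous_const (continuous_id.const_cpow (Or.inl h))
      fun s => by simp [Complex.cpow_eq_zero_iff, h]).continuousOn

/-- With `c` imaginary this turns a vertical shift into a twist of the coefficients by unimodular
factors. -/
theorem LSeries_mul_cpow_neg (a : ℕ → ℂ) (c s : ℂ) :
    LSeries (fun n => a n * (n : ℂ) ^ (-c)) s = LSeries a (s + c) := by
  refine tsum_congr fun n => ?_
  rcases eq_or_ne n 0 with rfl | hn
  · simp
  · have h : (n : ℂ) ≠ 0 := by exact_mod_cast hn
    rw [LSeries.term_of_ne_zero hn, LSeries.term_of_ne_zero hn, Complex.cpow_add _ _ h,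
      Complex.cpow_neg]
    field_simp

theorem LSeries_single {n : ℕ} (hn : n ≠ 0) (s : ℂ) :
    LSeries (Pi.single n 1) s = (n : ℂ) ^ (-s) := by
  rw [LSeries, tsum_eq_single n]
  · rw [LSeries.term_of_ne_zero hn, Complex.cpow_neg]
    simp
  · intro m hm
    simp [LSeries.term_def, hm]

theorem norm_two_cpow (s : ℂ) : ‖(2 : ℂ) ^ s‖ = (2 : ℝ) ^ s.re := by
  simpa using Complex.norm_natCast_cpow_of_pos (n := 2) two_pos s

theorem two_cpow_ne_zero (s : ℂ) : (2 : ℂ) ^ s ≠ 0 := by simp [Complex.cpow_eq_zero_iff]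

theorem norm_two_cpow_neg_lt_one {s : ℂ} (hs : 0 < s.re) : ‖(2 : ℂ) ^ (-s)‖ < 1 := by
  rw [norm_two_cpow]
  exact Real.rpow_lt_one_of_one_lt_of_neg one_lt_two (by simpa using hs)

/-- A bounded Wiener–Dirichlet series without constant term decays like `2 ^ (-s)`, with the same
bound. -/
theorem norm_LSeries_le_of_coeff_one_eq_zero (ha : Summable fun n => ‖a n‖) (h1 : a 1 = 0)
    (hb : ∀ s ∈ rightHalfPlane, ‖LSeries a s‖ ≤ 1) {s : ℂ} (hs : s ∈ rightHalfPlane) :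
    ‖(2 : ℂ) ^ s * LSeries a s‖ ≤ 1 := by
  have hcl : closure rightHalfPlane = {s : ℂ | 0 ≤ s.re} := Complex.closure_setOfPred_lt_re 0
  have hcont := continuousOn_LSeries_closedHalfPlane ha
  have hb' : ∀ s ∈ closure rightHalfPlane, ‖LSeries a s‖ ≤ 1 := fun s hs => by
    have hsub : rightHalfPlane ⊆ {x : ℂ | 0 ≤ x.re} ∩ (fun x => ‖LSeries a x‖) ⁻¹' Set.Iic 1 :=
      fun x hx => ⟨(show 0 < x.re from hx).le, hb x hx⟩
    exact (closure_minimal hsub (hcont.norm.preimage_isClosed_of_isClosed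
      (isClosed_le continuous_const Complex.continuous_re) isClosed_Iic) hs).2
  -- For `n ≥ 2`, `(2 / n) ^ Re s ≤ 1`. This crude bound only supplies the growth conditions of
  -- Phragmén–Lindelöf; the sharp constant comes from the imaginary axis, where `|2 ^ s| = 1`.
  have hbound : ∀ s : ℂ, 0 ≤ s.re → ‖(2 : ℂ) ^ s * LSeries a s‖ ≤ ∑' n, ‖a n‖ := fun s hs => by
    rw [LSeries, ← tsum_mul_left]
    refine tsum_of_norm_bounded ha.hasSum fun n => ?_
    rcases n with _ | _ | n
    · simp
    · simp [h1]
    · rw [norm_mul, norm_two_cpow, LSeries.norm_term_eq, if_neg (by omega), mul_div_left_comm]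
      refine mul_le_of_le_one_right (norm_nonneg _) (div_le_one_of_le₀ ?_ (by positivity))
      exact Real.rpow_le_rpow two_pos.le (by push_cast; linarith [Nat.cast_nonneg (α := ℝ) n]) hs
  refine PhragmenLindelof.right_half_plane_of_bounded_on_real
    (f := fun s => (2 : ℂ) ^ s * LSeries a s) ⟨?_, ?_⟩ ⟨0, two_pos, 0, ?_⟩ ?_ ?_ (le_of_lt hs)
  · intro z hz
    have h2 : DifferentiableAt ℂ (fun s : ℂ => (2 : ℂ) ^ s) z :=
      differentiableAt_id.const_cpow (Or.inl two_ne_zero)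
    exact (h2.mul (analyticOnNhd_LSeries_rightHalfPlane ha z hz).differentiableAt)
      |>.differentiableWithinAt
  · have h2 : Continuous fun s : ℂ => (2 : ℂ) ^ s :=
      continuous_id.const_cpow (Or.inl two_ne_zero)
    exact h2.continuousOn.mul (hcont.mono (le_of_eq hcl))
  · refine Asymptotics.IsBigO.of_bound (∑' n, ‖a n‖) (Filter.eventually_inf_principal.2
      (Filter.Eventually.of_forall fun z hz => ?_))
    simpa using hbound z (le_of_lt hz)
  · exact Filter.isBoundedUnder_of_eventually_le (a := ∑' n, ‖a n‖)
      ((Filter.eventually_ge_atTop 0).mono fun x hx => hbound x (by simpa using hx))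
  · intro x
    rw [norm_mul, norm_two_cpow]
    simpa using hb' (x * Complex.I) (by rw [hcl]; simp)

/-- A nonconstant Wiener–Dirichlet series whose constant term has modulus one takes values of
modulus greater than one. -/
theorem norm_coeff_one_ne_one (ha : Summable fun n => ‖a n‖)
    (hb : ∀ s ∈ rightHalfPlane, ‖LSeries a s‖ < 1) : ‖a 1‖ ≠ 1 := by
  classical
  intro h1
  have h10 : a 1 ≠ 0 := by rw [← norm_ne_zero_iff, h1]; exact one_ne_zero
  -- Index `0` is cleared too: `a 0` does not enter the series, but a nonzero value would be picked
  -- up by `Nat.find`.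
  let b : ℕ → ℂ := fun n => if n ≤ 1 then 0 else a n
  have hbs : Summable fun n => ‖b n‖ := ha.of_nonneg_of_le (fun _ => norm_nonneg _) fun n => by
    simp only [b]; split_ifs <;> simp
  have hab : ∀ s ∈ rightHalfPlane, LSeries a s = a 1 + LSeries b s := fun s hs => by
    have h : LSeries a s = LSeries (a 1 • LSeries.delta + b) s := by
      refine LSeries_congr (fun {n} hn => ?_) s
      rcases eq_or_ne n 1 with rfl | h
      · simp [b, LSeries.delta]
      · have : ¬ n ≤ 1 := by omega
        simp [b, LSeries.delta, h, this]
    have hd : LSeriesSummable LSeries.delta s := by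
      refine summable_of_ne_finset_zero (s := {1}) fun n hn => ?_
      have : n ≠ 1 := by simpa using hn
      simp [LSeries.term_def, LSeries.delta, this]
    rw [h, LSeries_add (hd.smul _) (wienerDirichlet_lseriesSummable hbs (le_of_lt hs)),
      LSeries_smul, LSeries_delta]
    simp
  by_cases hall : ∀ n, b n = 0
  · have h := hb 1 one_mem_rightHalfPlane
    rw [hab 1 one_mem_rightHalfPlane, show b = 0 from funext hall] at h
    simp [h1] at h
  push Not at hall
  obtain ⟨m, hm⟩ : ∃ m, m + 1 = Nat.find hall := by
    refine ⟨Nat.find hall - 1, Nat.sub_add_cancel (Nat.one_le_iff_ne_zero.mpr fun h => ?_)⟩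
    have := Nat.find_spec hall
    rw [h] at this
    simp [b] at this
  have hN : b (m + 1) ≠ 0 := by rw [hm]; exact Nat.find_spec hall
  have hlt : ∀ k ≤ m, b k = 0 := fun k hk => by
    have := Nat.find_min hall (m := k) (by omega)
    push Not at this
    exact this
  have hm1 : 1 ≤ m := by
    by_contra h
    have : m = 0 := by omega
    simp [b, this] at hN
  have hlog : Real.log (m + 1 : ℝ) ≠ 0 :=
    (Real.log_pos (by norm_cast; omega)).ne'
  have hm0 : ((m + 1 : ℕ) : ℂ) ≠ 0 := by exact_mod_cast Nat.succ_ne_zero m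
  -- the vertical shift that aligns the first nonconstant term with the constant term
  set z : ℂ := starRingEnd ℂ (a 1) * b (m + 1) with hz
  have hz0 : z ≠ 0 := mul_ne_zero (by simpa using h10) hN
  let t : ℝ := z.arg / Real.log (m + 1 : ℝ)
  have hrot : z * ((m + 1 : ℕ) : ℂ) ^ (-(t * Complex.I)) = ‖z‖ := by
    rw [Complex.cpow_def_of_ne_zero hm0, ← Complex.natCast_log]
    have : ((Real.log (m + 1 : ℕ) : ℝ) : ℂ) * -(t * Complex.I) = -(z.arg * Complex.I) := by
      have h : Real.log (m + 1 : ℝ) * t = z.arg := by simp only [t]; field_simp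
      have h' : ((Real.log (m + 1 : ℝ) : ℝ) : ℂ) * t = z.arg := by exact_mod_cast h
      push_cast at h' ⊢
      linear_combination -Complex.I * h'
    rw [this]
    nth_rw 1 [← Complex.norm_mul_exp_arg_mul_I z]
    rw [mul_assoc, ← Complex.exp_add]
    simp
  let c : ℕ → ℂ := fun n => b n * (n : ℂ) ^ (-(t * Complex.I))
  have hcs : Summable fun n => ‖c n‖ := hbs.of_nonneg_of_le (fun _ => norm_nonneg _) fun n => by
    rcases eq_or_ne n 0 with rfl | hn
    · simp [c, b]
    · simp only [c, norm_mul]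
      rw [Complex.norm_natCast_cpow_of_pos (Nat.pos_of_ne_zero hn)]
      simp
  -- The first nonconstant term dominates at `+∞`, so `conj (a 1) * LSeries c x` has positive real
  -- part for large `x`. Adding `|a 1| ^ 2 = 1` gives a value of modulus greater than one.
  have hlim := (LSeries.tendsto_cpow_mul_atTop (f := c) (n := m)
    (fun k hk => by simp [c, hlt k hk]) (abscissaOfAbsConv_lt_top_of_summable_norm hcs)).const_mul
    (starRingEnd ℂ (a 1))
  have hval : starRingEnd ℂ (a 1) * c (m + 1) = ‖z‖ := by
    rw [← hrot]; simp only [c, hz]; ring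
  rw [hval] at hlim
  have hre := (Complex.continuous_re.tendsto _).comp hlim
  have hev := hre.eventually (lt_mem_nhds (a := 0) (by simpa using hz0))
  obtain ⟨x, hx, hx0⟩ := (hev.and (Filter.eventually_gt_atTop 0)).exists
  have hs : (x : ℂ) + t * Complex.I ∈ rightHalfPlane := by simpa [rightHalfPlane] using hx0
  have hshift : LSeries c x = LSeries a (x + t * Complex.I) - a 1 := by
    rw [LSeries_mul_cpow_neg, hab _ hs]; ring
  have hpos : 0 < (starRingEnd ℂ (a 1) * LSeries c x).re := by
    have h : ((m : ℂ) + 1) ^ (x : ℂ) = (((m + 1 : ℝ) ^ x : ℝ) : ℂ) := by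
      rw [Complex.ofReal_cpow (by positivity)]; push_cast; rfl
    have hx' : 0 < (m + 1 : ℝ) ^ x * (starRingEnd ℂ (a 1) * LSeries c x).re := by
      rw [← Complex.re_ofReal_mul, ← h]
      have := hx
      rwa [Function.comp, mul_left_comm] at this
    exact pos_of_mul_pos_right hx' (by positivity)
  rw [hshift, mul_sub, Complex.sub_re, mul_comm _ (a 1), Complex.mul_conj, Complex.ofReal_re,
    Complex.normSq_eq_norm_sq, h1] at hpos
  have h2 := (Complex.re_le_norm _).trans_eq
    (norm_mul (starRingEnd ℂ (a 1)) (LSeries a (x + t * Complex.I)))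
  rw [RCLike.norm_conj, h1] at h2
  linarith [hb _ hs]

end WienerDirichletSeries

/-! ### Real parts under invertible self-maps of the half-plane. -/

/-- If `φ` has a continuous left inverse on the half-plane and `2 ^ (-φ)` is a Wiener–Dirichlet
series with nonvanishing constant term of modulus less than one, then `φ` would converge to an
interior point along the positive real axis, which is impossible. -/
theorem not_coeff_one_ne_zero_of_leftInverse {φ ψ : ℂ → ℂ} {a : ℕ → ℂ}
    (hφ : AnalyticOnNhd ℂ φ rightHalfPlane) (hψ : ContinuousOn ψ rightHalfPlane)
    (hinv : ∀ s ∈ rightHalfPlane, ψ (φ s) = s) (ha : Summable fun n => ‖a n‖)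
    (hser : ∀ s ∈ rightHalfPlane, (2 : ℂ) ^ (-φ s) = LSeries a s) (ha0 : a 1 ≠ 0) :
    ¬ ‖a 1‖ < 1 := by
  intro ha1
  have hl2 : (Real.log 2 : ℂ) ≠ 0 := by exact_mod_cast (Real.log_pos one_lt_two).ne'
  have hpow : ∀ z : ℂ, (2 : ℂ) ^ z = Complex.exp (z * Real.log 2) := fun z => by
    rw [Complex.cpow_def_of_ne_zero two_ne_zero, mul_comm, Complex.ofReal_log two_pos.le]
    simp
  have hlim : Filter.Tendsto (fun x : ℝ => LSeries a x / a 1) Filter.atTop (nhds 1) := by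
    have := (LSeries.tendsto_atTop (abscissaOfAbsConv_lt_top_of_summable_norm ha)).div_const (a 1)
    rwa [div_self ha0] at this
  obtain ⟨X, hX⟩ := Filter.eventually_atTop.1 ((hlim.eventually
    (Complex.isOpen_slitPlane.mem_nhds Complex.one_mem_slitPlane)).and
      (Filter.eventually_gt_atTop 0))
  -- `φ` is a logarithm of the series only up to a multiple of `2πi`. As `exp U` is constant, `U` is
  -- locally constant where the principal logarithm is holomorphic, which fixes the branch for large
  -- real `x`.
  let U : ℂ → ℂ := fun s => φ s * Real.log 2 + Complex.log (LSeries a s / a 1)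
  have hexp : ∀ s ∈ rightHalfPlane, Complex.exp (U s) = (a 1)⁻¹ := fun s hs => by
    have h0 : LSeries a s / a 1 ≠ 0 := by
      rw [← hser s hs]
      exact div_ne_zero (two_cpow_ne_zero _) ha0
    rw [Complex.exp_add, Complex.exp_log h0, ← hser s hs, hpow, neg_mul, Complex.exp_neg]
    field_simp
  have hder : ∀ x : ℝ, X ≤ x → HasDerivAt (fun x : ℝ => U x) 0 x := fun x hx => by
    obtain ⟨hslit, hx0⟩ := hX x hx
    have hmem := ofReal_mem_rightHalfPlane hx0
    have hU : DifferentiableAt ℂ U x :=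
      ((hφ _ hmem).differentiableAt.mul_const _).add
        (((analyticOnNhd_LSeries_rightHalfPlane ha _ hmem).differentiableAt.div_const _).clog hslit)
    have h1 : HasDerivAt (fun s => Complex.exp (U s)) 0 (x : ℂ) :=
      (hasDerivAt_const (x : ℂ) (a 1)⁻¹).congr_of_eventuallyEq
        (Filter.eventually_of_mem (isOpen_rightHalfPlane.mem_nhds hmem) hexp)
    have h2 := h1.unique hU.hasDerivAt.cexp
    have h3 : deriv U x = 0 := by simpa [Complex.exp_ne_zero] using h2.symm
    have h4 := hU.hasDerivAt
    rw [h3] at h4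
    exact h4.comp_ofReal
  have hconst : ∀ x : ℝ, X < x → U x = U (X + 1 : ℝ) := fun x hx =>
    isOpen_Ioi.is_const_of_deriv_eq_zero (f := fun x : ℝ => U x) isPreconnected_Ioi
      (fun y hy => (hder y (le_of_lt hy)).differentiableAt.differentiableWithinAt)
      (fun y hy => (hder y (le_of_lt hy)).deriv) hx (Set.mem_Ioi.2 (lt_add_one X))
  set c : ℂ := U (X + 1 : ℝ) / Real.log 2 with hc
  have hφlim : Filter.Tendsto (fun x : ℝ => φ x) Filter.atTop (nhds c) := by
    have h := ((tendsto_const_nhds (x := U (X + 1 : ℝ))).sub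
      (hlim.clog Complex.one_mem_slitPlane)).div_const (Real.log 2 : ℂ)
    rw [Complex.log_one, sub_zero] at h
    refine h.congr' ((Filter.eventually_gt_atTop X).mono fun x hx => ?_)
    rw [← hconst x hx]
    simp only [U]
    field_simp
    ring
  -- Here `|2 ^ (-c)| = |a 1| < 1`, which rules out a boundary limit.
  have hcmem : c ∈ rightHalfPlane := by
    have h1 : Filter.Tendsto (fun x : ℝ => (2 : ℂ) ^ (-φ x)) Filter.atTop (nhds (a 1)) :=
      (LSeries.tendsto_atTop (abscissaOfAbsConv_lt_top_of_summable_norm ha)).congr'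
        ((Filter.eventually_gt_atTop 0).mono fun x hx =>
          (hser _ (ofReal_mem_rightHalfPlane hx)).symm)
    have h2 := tendsto_nhds_unique h1 (hφlim.neg.const_cpow (Or.inl two_ne_zero))
    rw [h2, norm_two_cpow] at ha1
    by_contra hcon
    have hcon' : c.re ≤ 0 := not_lt.1 hcon
    exact absurd (Real.one_le_rpow one_le_two (by simpa using hcon')) (not_le.2 ha1)
  have hψlim := ((hψ.continuousAt (isOpen_rightHalfPlane.mem_nhds hcmem)).tendsto.comp hφlim)
  have hre : Filter.Tendsto (fun x : ℝ => x) Filter.atTop (nhds (ψ c).re) :=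
    ((Complex.continuous_re.tendsto _).comp hψlim).congr'
      ((Filter.eventually_gt_atTop 0).mono fun x hx => by
        simp [hinv _ (ofReal_mem_rightHalfPlane hx)])
  exact not_tendsto_nhds_of_tendsto_atTop Filter.tendsto_id _ hre

/-- A self-map `φ` of the half-plane with a continuous left inverse does not decrease real parts
as soon as `2 ^ (-φ)` is a Wiener–Dirichlet series. -/
theorem re_le_re_of_leftInverse {φ ψ : ℂ → ℂ} {a : ℕ → ℂ}
    (hmaps : Set.MapsTo φ rightHalfPlane rightHalfPlane)
    (hφ : AnalyticOnNhd ℂ φ rightHalfPlane) (hψ : ContinuousOn ψ rightHalfPlane)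
    (hinv : ∀ s ∈ rightHalfPlane, ψ (φ s) = s) (ha : Summable fun n => ‖a n‖)
    (hser : ∀ s ∈ rightHalfPlane, (2 : ℂ) ^ (-φ s) = LSeries a s) {s : ℂ}
    (hs : s ∈ rightHalfPlane) : s.re ≤ (φ s).re := by
  have hlt : ∀ s ∈ rightHalfPlane, ‖LSeries a s‖ < 1 := fun s hs => by
    rw [← hser s hs]
    exact norm_two_cpow_neg_lt_one (hmaps hs)
  have h1le : ‖a 1‖ ≤ 1 :=
    le_of_tendsto (LSeries.tendsto_atTop (abscissaOfAbsConv_lt_top_of_summable_norm ha)).norm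
      ((Filter.eventually_gt_atTop 0).mono fun x hx => (hlt _ (ofReal_mem_rightHalfPlane hx)).le)
  have h10 : a 1 = 0 := by
    by_contra h
    exact not_coeff_one_ne_zero_of_leftInverse hφ hψ hinv ha hser h
      (lt_of_le_of_ne h1le (norm_coeff_one_ne_one ha hlt))
  have h := norm_LSeries_le_of_coeff_one_eq_zero ha h10 (fun s hs => (hlt s hs).le) hs
  rw [← hser s hs, ← Complex.cpow_add _ _ two_ne_zero, norm_two_cpow] at h
  by_contra hcon
  refine absurd h (not_le.2 (Real.one_lt_rpow one_lt_two ?_))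
  simpa using hcon

/-- A holomorphic self-map of the half-plane that preserves real parts is a vertical
translation. -/
theorem exists_eq_add_I_mul_of_re_eq {φ : ℂ → ℂ} (hφ : AnalyticOnNhd ℂ φ rightHalfPlane)
    (hre : ∀ s ∈ rightHalfPlane, (φ s).re = s.re) :
    ∃ τ : ℝ, ∀ s ∈ rightHalfPlane, φ s = s + Complex.I * τ := by
  have han : AnalyticOnNhd ℂ (fun s => φ s - s) rightHalfPlane := hφ.sub analyticOnNhd_id
  rcases han.is_constant_or_isOpen isPreconnected_rightHalfPlane with ⟨w, hw⟩ | hopen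
  · refine ⟨w.im, fun s hs => ?_⟩
    have h1 := hw s hs
    have h2 : w.re = 0 := by rw [← h1]; simp [hre s hs]
    rw [← Complex.re_add_im w, h2] at h1
    simp only [Complex.ofReal_zero, zero_add] at h1
    linear_combination h1
  · have h := hopen _ subset_rfl isOpen_rightHalfPlane
    have hmem : φ 1 - 1 ∈ (fun s => φ s - s) '' rightHalfPlane :=
      ⟨1, one_mem_rightHalfPlane, rfl⟩
    obtain ⟨ε, hε, hball⟩ := Metric.isOpen_iff.1 h _ hmem
    -- The image of `φ - id` lies on the imaginary axis; an open image would also contain a point `ε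
    -- / 2` to the right of it.
    obtain ⟨s, hs, hsw⟩ := hball (a := φ 1 - 1 + (ε / 2 : ℝ)) (by
      rw [Metric.mem_ball, dist_self_add_left, Complex.norm_real, Real.norm_eq_abs,
        abs_of_pos (by positivity)]
      linarith)
    have := congrArg Complex.re hsw
    simp only [Complex.sub_re, Complex.add_re, Complex.ofReal_re, hre s hs,
      hre 1 one_mem_rightHalfPlane] at this
    linarith

/-! ### Inverting `φ` by means of `2 ^ (-s)` and `3 ^ (-s)`. -/

open Filter Topology in
/-- Near a point, `(z - w) f'(z) / f(z)` tends to the order of vanishing of `f`. -/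
theorem AnalyticAt.exists_tendsto_sub_mul_deriv_div {f : ℂ → ℂ} {w : ℂ} (hf : AnalyticAt ℂ f w)
    (hne : ¬ ∀ᶠ z in 𝓝 w, f z = 0) :
    ∃ m : ℕ, (f w = 0 → m ≠ 0) ∧
      Tendsto (fun z => (z - w) * (deriv f z / f z)) (𝓝[≠] w) (𝓝 m) := by
  obtain ⟨m, g, hg, hgw, hfg⟩ := hf.exists_eventuallyEq_pow_smul_nonzero_iff.2 hne
  refine ⟨m, fun h0 hm => hgw ?_, ?_⟩
  · have := hfg.self_of_nhds
    rw [h0, hm] at this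
    simpa using this.symm
  -- Writing `f = (z - w) ^ m g` with `g w ≠ 0` gives `(z - w) f' / f = m + (z - w) g' / g`.
  · have hlim : Tendsto (fun z => (m : ℂ) + (z - w) * (deriv g z / g z)) (𝓝[≠] w) (𝓝 m) := by
      have hc : ContinuousAt (fun z => (m : ℂ) + (z - w) * (deriv g z / g z)) w :=
        continuousAt_const.add ((continuousAt_id.sub continuousAt_const).mul
          (hg.deriv.continuousAt.div hg.continuousAt hgw))
      have := hc.tendsto
      simp only [sub_self, zero_mul, add_zero] at this
      exact this.mono_left nhdsWithin_le_nhds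
    refine hlim.congr' ?_
    filter_upwards [self_mem_nhdsWithin, nhdsWithin_le_nhds hfg.eventually_nhds,
      nhdsWithin_le_nhds hg.eventually_analyticAt,
      nhdsWithin_le_nhds (hg.continuousAt.eventually_ne hgw)] with z hzw hfz hgz hg0
    have hz : z - w ≠ 0 := sub_ne_zero.2 hzw
    have hd := (((hasDerivAt_id z).sub_const w).pow m).mul hgz.differentiableAt.hasDerivAt
    have hfd : HasDerivAt f _ z := hd.congr_of_eventuallyEq (hfz.mono fun y hy => by simpa using hy)
    rw [hfd.deriv, hfz.self_of_nhds]
    rcases m with _ | m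
    · simp
    · simp only [id, smul_eq_mul, Nat.add_sub_cancel, pow_succ]
      field_simp
      simp
      ring

theorem natCast_mul_log_three_ne {m k : ℕ} (hm : m ≠ 0) :
    (m : ℝ) * Real.log 3 ≠ k * Real.log 2 := by
  intro h
  rw [← Real.log_pow, ← Real.log_pow] at h
  have h' : (3 : ℝ) ^ m = 2 ^ k :=
    Real.log_injOn_pos (Set.mem_Ioi.2 (by positivity)) (Set.mem_Ioi.2 (by positivity)) h
  have h'' : 3 ^ m = 2 ^ k := by exact_mod_cast h'
  have h3 : Nat.Prime 3 := Nat.prime_three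
  have : 3 ∣ 2 := h3.dvd_of_dvd_pow (h'' ▸ dvd_pow_self 3 hm)
  omega

section LeftInverse

variable {φ G H : ℂ → ℂ}

theorem hasDerivAt_natCast_cpow_neg {n : ℕ} (hn : n ≠ 0) (s : ℂ) :
    HasDerivAt (fun s : ℂ => (n : ℂ) ^ (-s)) (-(Real.log n * (n : ℂ) ^ (-s))) s := by
  have h := (hasDerivAt_neg s).const_cpow (c := (n : ℂ)) (Or.inl (by exact_mod_cast hn))
  convert h using 1
  rw [Complex.natCast_log]
  ring

theorem isOpen_image_of_comp_eq_two_cpow_neg (hφ : AnalyticOnNhd ℂ φ rightHalfPlane)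
    (hG : ∀ s ∈ rightHalfPlane, G (φ s) = (2 : ℂ) ^ (-s)) : IsOpen (φ '' rightHalfPlane) := by
  rcases hφ.is_constant_or_isOpen isPreconnected_rightHalfPlane with ⟨w, hw⟩ | hopen
  · have h2 : (2 : ℂ) ∈ rightHalfPlane := by simp [rightHalfPlane]
    have h := hG 1 one_mem_rightHalfPlane
    rw [hw 1 one_mem_rightHalfPlane, ← hw 2 h2, hG 2 h2, Complex.cpow_neg, Complex.cpow_neg] at h
    norm_num at h
  · exact hopen _ subset_rfl isOpen_rightHalfPlane

/-- Identity theorem: an analytic identity need only be checked after composition with `φ`, even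
before `φ` is known to be onto. -/
theorem eqOn_rightHalfPlane_of_comp_eq {F₁ F₂ : ℂ → ℂ}
    (hmaps : Set.MapsTo φ rightHalfPlane rightHalfPlane) (hopen : IsOpen (φ '' rightHalfPlane))
    (hF₁ : AnalyticOnNhd ℂ F₁ rightHalfPlane) (hF₂ : AnalyticOnNhd ℂ F₂ rightHalfPlane)
    (h : ∀ s ∈ rightHalfPlane, F₁ (φ s) = F₂ (φ s)) : Set.EqOn F₁ F₂ rightHalfPlane := by
  refine hF₁.eqOn_of_preconnected_of_eventuallyEq hF₂ isPreconnected_rightHalfPlane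
    (hmaps one_mem_rightHalfPlane) (Filter.eventually_of_mem
      (hopen.mem_nhds ⟨1, one_mem_rightHalfPlane, rfl⟩) ?_)
  rintro _ ⟨s, hs, rfl⟩
  exact h s hs

/-- If both `2 ^ (-s)` and `3 ^ (-s)` factor through `φ`, the factor of `2 ^ (-s)` has no zeros:
the logarithmic derivatives of the two factors are proportional with irrational ratio. -/
theorem ne_zero_of_comp_eq_cpow_neg (hmaps : Set.MapsTo φ rightHalfPlane rightHalfPlane)
    (hφ : AnalyticOnNhd ℂ φ rightHalfPlane) (hGa : AnalyticOnNhd ℂ G rightHalfPlane)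
    (hHa : AnalyticOnNhd ℂ H rightHalfPlane)
    (hG : ∀ s ∈ rightHalfPlane, G (φ s) = (2 : ℂ) ^ (-s))
    (hH : ∀ s ∈ rightHalfPlane, H (φ s) = (3 : ℂ) ^ (-s)) {w : ℂ} (hw : w ∈ rightHalfPlane) :
    G w ≠ 0 := by
  intro hGw
  have hopen := isOpen_image_of_comp_eq_two_cpow_neg hφ hG
  have hchain : ∀ (n : ℕ) (_ : n ≠ 0) (F : ℂ → ℂ) (_ : AnalyticOnNhd ℂ F rightHalfPlane)
      (_ : ∀ s ∈ rightHalfPlane, F (φ s) = (n : ℂ) ^ (-s)), ∀ s ∈ rightHalfPlane,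
      deriv F (φ s) * deriv φ s = -(Real.log n * (n : ℂ) ^ (-s)) := by
    intro n hn F hFa hF s hs
    have h1 := (hFa _ (hmaps hs)).differentiableAt.hasDerivAt.comp s
      (hφ s hs).differentiableAt.hasDerivAt
    exact h1.unique ((hasDerivAt_natCast_cpow_neg hn s).congr_of_eventuallyEq
      (Filter.eventually_of_mem (isOpen_rightHalfPlane.mem_nhds hs) hF))
  have hG' := hchain 2 two_ne_zero G hGa (by simpa using hG)
  have hH' := hchain 3 three_ne_zero H hHa (by simpa using hH)
  push_cast at hG' hH'
  have hl2 : (Real.log 2 : ℂ) ≠ 0 := by exact_mod_cast (Real.log_pos one_lt_two).ne'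
  -- This is `log 3 · G' / G = log 2 · H' / H` with denominators cleared, so that it makes sense at
  -- zeros of `G` and `H`.
  have hprop : Set.EqOn (fun z => Real.log 3 * (deriv G z * H z))
      (fun z => Real.log 2 * (deriv H z * G z)) rightHalfPlane := by
    refine eqOn_rightHalfPlane_of_comp_eq hmaps hopen
      (analyticOnNhd_const.mul (hGa.deriv.mul hHa)) (analyticOnNhd_const.mul (hHa.deriv.mul hGa))
      fun s hs => ?_
    have hd : deriv φ s ≠ 0 := fun h => by
      have := hG' s hs
      rw [h, mul_zero, eq_comm, neg_eq_zero] at this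
      exact mul_ne_zero hl2 (two_cpow_ne_zero _) this
    refine mul_right_cancel₀ hd ?_
    rw [hG s hs, hH s hs]
    linear_combination (Real.log 3 * (3 : ℂ) ^ (-s)) * hG' s hs -
      (Real.log 2 * (2 : ℂ) ^ (-s)) * hH' s hs
  have hnz : ∀ F : ℂ → ℂ, AnalyticOnNhd ℂ F rightHalfPlane → F (φ 1) ≠ 0 →
      ¬ ∀ᶠ z in nhds w, F z = 0 := fun F hFa hF1 h => hF1
    (hFa.eqOn_zero_of_preconnected_of_eventuallyEq_zero isPreconnected_rightHalfPlane hw h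
      (hmaps one_mem_rightHalfPlane))
  have hGn := hnz G hGa (by rw [hG 1 one_mem_rightHalfPlane]; exact two_cpow_ne_zero _)
  have hHn := hnz H hHa (by
    rw [hH 1 one_mem_rightHalfPlane]; simp [Complex.cpow_eq_zero_iff])
  obtain ⟨m, hm, hmlim⟩ := (hGa w hw).exists_tendsto_sub_mul_deriv_div hGn
  obtain ⟨k, -, hklim⟩ := (hHa w hw).exists_tendsto_sub_mul_deriv_div hHn
  have h1 := hmlim.const_mul (Real.log 3 : ℂ)
  have h2 := hklim.const_mul (Real.log 2 : ℂ)
  -- Multiplying the logarithmic derivatives by `z - w` and letting `z → w` gives `m log 3 = k log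
  -- 2` for the orders of vanishing `m`, `k`.
  have heq := tendsto_nhds_unique (h1.congr' ?_) h2
  · refine natCast_mul_log_three_ne (hm hGw) (k := k) ?_
    have : Real.log 3 * (m : ℝ) = Real.log 2 * k := by exact_mod_cast heq
    linarith
  · have hG0 := ((hGa w hw).eventually_eq_zero_or_eventually_ne_zero).resolve_left hGn
    have hH0 := ((hHa w hw).eventually_eq_zero_or_eventually_ne_zero).resolve_left hHn
    filter_upwards [hG0, hH0, nhdsWithin_le_nhds (isOpen_rightHalfPlane.mem_nhds hw)]
      with z hGz hHz hz
    have := hprop hz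
    simp only at this
    field_simp
    linear_combination (z - w) * this

/-- If `2 ^ (-s)` and `3 ^ (-s)` factor through `φ`, with the factor of `2 ^ (-s)` bounded by one,
then `φ` is invertible. -/
theorem exists_inverse_of_comp_eq_cpow_neg (hmaps : Set.MapsTo φ rightHalfPlane rightHalfPlane)
    (hφ : AnalyticOnNhd ℂ φ rightHalfPlane) (hGa : AnalyticOnNhd ℂ G rightHalfPlane)
    (hHa : AnalyticOnNhd ℂ H rightHalfPlane)
    (hG : ∀ s ∈ rightHalfPlane, G (φ s) = (2 : ℂ) ^ (-s))
    (hH : ∀ s ∈ rightHalfPlane, H (φ s) = (3 : ℂ) ^ (-s))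
    (hG1 : ∀ s ∈ rightHalfPlane, ‖G s‖ ≤ 1) :
    ∃ ψ : ℂ → ℂ, Set.MapsTo ψ rightHalfPlane rightHalfPlane ∧
      AnalyticOnNhd ℂ ψ rightHalfPlane ∧ (∀ s ∈ rightHalfPlane, ψ (φ s) = s) ∧
      (∀ s ∈ rightHalfPlane, φ (ψ s) = s) ∧ ∀ s ∈ rightHalfPlane, (2 : ℂ) ^ (-ψ s) = G s := by
  have hopen := isOpen_image_of_comp_eq_two_cpow_neg hφ hG
  have h0 : ∀ w ∈ rightHalfPlane, G w ≠ 0 := fun w hw =>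
    ne_zero_of_comp_eq_cpow_neg hmaps hφ hGa hHa hG hH hw
  have hl2 : (Real.log 2 : ℂ) ≠ 0 := by exact_mod_cast (Real.log_pos one_lt_two).ne'
  -- The derivative that `-log G / log 2` must have; convexity provides a primitive, and the
  -- additive constant is then chosen so that `ψ (φ 1) = 1`.
  have hq : DifferentiableOn ℂ (fun z => -(deriv G z / (Real.log 2 * G z))) rightHalfPlane :=
    fun z hz => ((hGa.deriv z hz).differentiableAt.div
      ((hGa z hz).differentiableAt.const_mul _)
        (mul_ne_zero hl2 (h0 z hz))).neg.differentiableWithinAt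
  obtain ⟨ψ₀, hψ₀⟩ := convex_rightHalfPlane.exists_forall_hasDerivWithinAt hq
  let ψ : ℂ → ℂ := fun z => ψ₀ z - ψ₀ (φ 1) + 1
  have hψd : ∀ z ∈ rightHalfPlane, HasDerivAt ψ (-(deriv G z / (Real.log 2 * G z))) z :=
    fun z hz => (((hψ₀ z hz).hasDerivAt (isOpen_rightHalfPlane.mem_nhds hz)).sub_const _).add_const _
  have hψa : AnalyticOnNhd ℂ ψ rightHalfPlane :=
    DifferentiableOn.analyticOnNhd
      (fun z hz => (hψd z hz).differentiableAt.differentiableWithinAt) isOpen_rightHalfPlane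
  have hleft : ∀ s ∈ rightHalfPlane, ψ (φ s) = s := by
    have hder : ∀ s ∈ rightHalfPlane, HasDerivAt (fun s => ψ (φ s) - s) 0 s := fun s hs => by
      have h1 := (hψd _ (hmaps hs)).comp s (hφ s hs).differentiableAt.hasDerivAt
      have h2 := ((hGa _ (hmaps hs)).differentiableAt.hasDerivAt.comp s
        (hφ s hs).differentiableAt.hasDerivAt).unique
          ((hasDerivAt_natCast_cpow_neg two_ne_zero s).congr_of_eventuallyEq
            (Filter.eventually_of_mem (isOpen_rightHalfPlane.mem_nhds hs) (by simpa using hG)))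
      push_cast at h2
      have h3 : -(deriv G (φ s) / (Real.log 2 * G (φ s))) * deriv φ s - 1 = 0 := by
        have h4 := two_cpow_ne_zero (-s)
        rw [hG s hs]
        field_simp
        linear_combination -h2
      exact h3 ▸ h1.sub (hasDerivAt_id s)
    intro s hs
    have := isOpen_rightHalfPlane.is_const_of_deriv_eq_zero (f := fun s => ψ (φ s) - s)
      isPreconnected_rightHalfPlane
      (fun y hy => (hder y hy).differentiableAt.differentiableWithinAt)
      (fun y hy => (hder y hy).deriv) hs one_mem_rightHalfPlane
    simp only [ψ, sub_self, zero_add] at this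
    exact sub_eq_zero.1 this
  have hpow : Set.EqOn (fun s => (2 : ℂ) ^ (-ψ s)) G rightHalfPlane := by
    refine eqOn_rightHalfPlane_of_comp_eq hmaps hopen ?_ hGa fun s hs => ?_
    · exact DifferentiableOn.analyticOnNhd (fun z hz =>
        ((hψa z hz).differentiableAt.neg.const_cpow
          (Or.inl two_ne_zero)).differentiableWithinAt) isOpen_rightHalfPlane
    · rw [hleft s hs, hG s hs]
  have hψmaps : Set.MapsTo ψ rightHalfPlane rightHalfPlane := by
    intro w hw
    by_contra hcon
    have hcon' : (ψ w).re ≤ 0 := not_lt.1 hcon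
    -- If `Re ψ(w) ≤ 0`, then `|G w| ≥ 1` is a maximum of `|G|`, so `G` is constant, although `G (φ
    -- 1) ≠ G (φ 2)`.
    have hmax : IsMaxOn (norm ∘ G) rightHalfPlane w := fun z hz => by
      refine (hG1 z hz).trans ?_
      rw [Function.comp, ← hpow hw, norm_two_cpow]
      exact Real.one_le_rpow one_le_two (by simpa using hcon')
    have hc := Complex.eqOn_of_isPreconnected_of_isMaxOn_norm isPreconnected_rightHalfPlane
      isOpen_rightHalfPlane hGa.differentiableOn hw hmax
    have h2 : (2 : ℂ) ∈ rightHalfPlane := by simp [rightHalfPlane]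
    have h := (hc (hmaps one_mem_rightHalfPlane)).trans (hc (hmaps h2)).symm
    rw [hG 1 one_mem_rightHalfPlane, hG 2 h2, Complex.cpow_neg, Complex.cpow_neg] at h
    norm_num at h
  refine ⟨ψ, hψmaps, hψa, hleft, ?_, hpow⟩
  exact eqOn_rightHalfPlane_of_comp_eq hmaps hopen (hφ.comp hψa hψmaps) analyticOnNhd_id
    fun s hs => by simp [hleft s hs]

end LeftInverse

/-! ### Automorphisms of the algebra and the forward implication. -/

/-- The function `s ↦ n ^ (-s)` as an element of the Wiener–Dirichlet algebra. -/
noncomputable def natCastCpowNeg (n : ℕ) (hn : n ≠ 0) : wienerDirichletAlgebra :=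
  ⟨fun s => (n : ℂ) ^ (-(s : ℂ)), Pi.single n 1,
    summable_of_ne_finset_zero (s := {n}) fun m hm => by
      have : m ≠ n := by simpa using hm
      simp [this],
    fun s => (LSeries_single hn s).symm⟩

/-- For `|μ| < 1`, the function `1 - μ 2 ^ (-s)` is invertible in the Wiener–Dirichlet algebra. -/
theorem isUnit_one_sub_smul_two_cpow_neg {μ : ℂ} (hμ : ‖μ‖ < 1) :
    IsUnit (1 - μ • natCastCpowNeg 2 two_ne_zero) := by
  classical
  -- the inverse is `∑ μ ^ k (2 ^ k) ^ (-s)`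
  let c : ℕ → ℂ := Function.extend (fun k : ℕ => 2 ^ k) (fun k => μ ^ k) 0
  have hinj : Function.Injective (fun k : ℕ => 2 ^ k) := Nat.pow_right_injective le_rfl
  have hck : ∀ k : ℕ, c (2 ^ k) = μ ^ k := fun k => hinj.extend_apply _ _ k
  have hsupp : ∀ x ∉ Set.range (fun k : ℕ => 2 ^ k), c x = 0 := fun x hx =>
    Function.extend_apply' _ _ _ hx
  have hc : Summable fun n => ‖c n‖ := by
    refine (hinj.summable_iff fun x hx => by simp [hsupp x hx]).1 ?_
    refine (summable_geometric_of_lt_one (norm_nonneg μ) hμ).congr fun k => ?_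
    simp [Function.comp, hck]
  have hsum : ∀ s : rightHalfPlane, LSeries c s = (1 - μ * (2 : ℂ) ^ (-(s : ℂ)))⁻¹ := fun s => by
    rw [LSeries, ← hinj.tsum_eq]
    · rw [← tsum_geometric_of_norm_lt_one]
      · refine tsum_congr fun k => ?_
        have hne : (2 : ℕ) ^ k ≠ 0 := by positivity
        rw [LSeries.term_of_ne_zero hne, hck, mul_pow, ← Complex.cpow_nat_mul,
          div_eq_mul_inv, ← Complex.cpow_neg]
        congr 1
        push_cast
        simpa using (Complex.natCast_cpow_natCast_mul 2 k (-(s : ℂ))).symm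
      · rw [norm_mul]
        exact mul_lt_one_of_nonneg_of_lt_one_left (norm_nonneg _) hμ
          (norm_two_cpow_neg_lt_one s.2).le
    · intro x hx
      by_contra h
      exact hx (by simp [LSeries.term_def, hsupp x h])
  refine IsUnit.of_mul_eq_one ⟨fun s => LSeries c s, c, hc, fun s => rfl⟩
    (Subtype.ext (funext fun s => ?_))
  have hne : (1 - μ * (2 : ℂ) ^ (-(s : ℂ))) ≠ 0 := by
    refine sub_ne_zero.2 fun h => ?_
    have h' := congrArg norm h
    rw [norm_one, norm_mul] at h'
    exact absurd h'.symm (ne_of_lt (mul_lt_one_of_nonneg_of_lt_one_left (norm_nonneg _) hμ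
      (norm_two_cpow_neg_lt_one s.2).le))
  have : (1 - μ * (2 : ℂ) ^ (-(s : ℂ))) * LSeries c s = 1 := by
    rw [hsum, mul_inv_cancel₀ hne]
  simpa [natCastCpowNeg] using this

/-- Spectra are preserved by `T`: for a value `v` of modulus greater than one, `1 - v⁻¹ 2 ^ (-s)` is
invertible, yet its image under `T` vanishes at `s`. -/
theorem norm_algEquiv_two_cpow_neg_le_one
    (T : wienerDirichletAlgebra ≃ₐ[ℂ] wienerDirichletAlgebra) (s : rightHalfPlane) :
    ‖(T (natCastCpowNeg 2 two_ne_zero) : rightHalfPlane → ℂ) s‖ ≤ 1 := by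
  by_contra! h
  set v := (T (natCastCpowNeg 2 two_ne_zero) : rightHalfPlane → ℂ) s with hv
  have hv0 : v ≠ 0 := norm_pos_iff.1 (zero_lt_one.trans h)
  have hu := (isUnit_one_sub_smul_two_cpow_neg (μ := v⁻¹)
    (by rw [norm_inv]; exact inv_lt_one_of_one_lt₀ h)).map T
  obtain ⟨b, hb⟩ := hu.exists_right_inv
  have := congrFun (congrArg Subtype.val hb) s
  simp [← hv, hv0] at this

theorem CompositionIsAutomorphism.exists_translation {φ : ℂ → ℂ}
    (hmaps : Set.MapsTo φ rightHalfPlane rightHalfPlane)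
    (hφ : AnalyticOnNhd ℂ φ rightHalfPlane)
    (h : CompositionIsAutomorphism (hmaps.restrict φ rightHalfPlane rightHalfPlane)) :
    ∃ τ : ℝ, ∀ s ∈ rightHalfPlane, φ s = s + Complex.I * τ := by
  obtain ⟨T, hT⟩ := h
  have hinv : ∀ (n : ℕ) (hn : n ≠ 0) (s : ℂ) (hs : s ∈ rightHalfPlane),
      (T.symm (natCastCpowNeg n hn) : rightHalfPlane → ℂ) ⟨φ s, hmaps hs⟩ = (n : ℂ) ^ (-s) := by
    intro n hn s hs
    have h1 := congrFun (hT (T.symm (natCastCpowNeg n hn))) ⟨s, hs⟩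
    rw [AlgEquiv.apply_symm_apply] at h1
    exact h1.symm
  obtain ⟨b, hb, hGb⟩ := (T.symm (natCastCpowNeg 2 two_ne_zero)).2
  obtain ⟨d, hd, hHd⟩ := (T.symm (natCastCpowNeg 3 three_ne_zero)).2
  obtain ⟨a, ha, hFa⟩ := (T (natCastCpowNeg 2 two_ne_zero)).2
  obtain ⟨ψ, hψmaps, hψ, hleft, hright, hpow⟩ := exists_inverse_of_comp_eq_cpow_neg hmaps hφ
    (analyticOnNhd_LSeries_rightHalfPlane hb) (analyticOnNhd_LSeries_rightHalfPlane hd)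
    (fun s hs => by rw [← hGb ⟨φ s, hmaps hs⟩, hinv _ _ s hs]; simp)
    (fun s hs => by rw [← hHd ⟨φ s, hmaps hs⟩, hinv _ _ s hs]; simp)
    (fun s hs => by
      rw [← hGb ⟨s, hs⟩]
      exact norm_algEquiv_two_cpow_neg_le_one T.symm ⟨s, hs⟩)
  have hser : ∀ s ∈ rightHalfPlane, (2 : ℂ) ^ (-φ s) = LSeries a s := fun s hs => by
    rw [← hFa ⟨s, hs⟩, hT]
    simp [natCastCpowNeg]
  refine exists_eq_add_I_mul_of_re_eq hφ fun s hs => le_antisymm ?_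
    (re_le_re_of_leftInverse hmaps hφ hψ.continuousOn hleft ha hser hs)
  -- The roles of `φ` and `ψ` are exchanged, and the inequality is evaluated at `φ s`.
  have := re_le_re_of_leftInverse hψmaps hψ hφ.continuousOn hright hb hpow (hmaps hs)
  rwa [hleft s hs] at this

/-! ### Vertical translations and the conclusion. -/

theorem IsWienerDirichlet.comp_translation {f : rightHalfPlane → ℂ} (hf : IsWienerDirichlet f)
    {φ : rightHalfPlane → rightHalfPlane} {τ : ℝ}
    (hφ : ∀ s, (φ s : ℂ) = s + Complex.I * τ) : IsWienerDirichlet (f ∘ φ) := by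
  obtain ⟨a, ha, hfa⟩ := hf
  refine ⟨fun n => a n * (n : ℂ) ^ (-(Complex.I * τ)), ha.of_nonneg_of_le
    (fun _ => norm_nonneg _) fun n => ?_, fun s => ?_⟩
  · rw [norm_mul]
    refine mul_le_of_le_one_right (norm_nonneg _) ?_
    rcases eq_or_ne n 0 with rfl | hn
    -- At index `0` the twist is `0 ^ 0 = 1` or `0`, of norm at most one in both cases.
    · by_cases hτ : τ = 0 <;> simp [hτ]
    · rw [Complex.norm_natCast_cpow_of_pos (Nat.pos_of_ne_zero hn)]
      simp
  · rw [LSeries_mul_cpow_neg, Function.comp, hfa, hφ]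

theorem compositionIsAutomorphism_of_translation {φ : rightHalfPlane → rightHalfPlane} {τ : ℝ}
    (hφ : ∀ s, (φ s : ℂ) = s + Complex.I * τ) : CompositionIsAutomorphism φ := by
  let ψ : rightHalfPlane → rightHalfPlane := fun s =>
    ⟨s + Complex.I * (-τ : ℝ), by simpa [rightHalfPlane] using s.2⟩
  have hψ : ∀ s, (ψ s : ℂ) = s + Complex.I * (-τ : ℝ) := fun _ => rfl
  have hψφ : ∀ s, ψ (φ s) = s := fun s => Subtype.ext (by rw [hψ, hφ]; push_cast; ring)
  have hφψ : ∀ s, φ (ψ s) = s := fun s => Subtype.ext (by rw [hφ, hψ]; push_cast; ring)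
  exact ⟨{
    toFun := fun f => ⟨(f : rightHalfPlane → ℂ) ∘ φ, IsWienerDirichlet.comp_translation f.2 hφ⟩
    invFun := fun f => ⟨(f : rightHalfPlane → ℂ) ∘ ψ, IsWienerDirichlet.comp_translation f.2 hψ⟩
    left_inv := fun f => Subtype.ext (funext fun s => congrArg f.1 (hφψ s))
    right_inv := fun f => Subtype.ext (funext fun s => congrArg f.1 (hψφ s))
    map_mul' := fun _ _ => rfl
    map_add' := fun _ _ => rfl
    commutes' := fun _ => rfl }, fun _ => rfl⟩

theorem theorem3p4 (φ : ℂ → ℂ) (hmaps : Set.MapsTo φ rightHalfPlane rightHalfPlane)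
    (hφ : AnalyticOnNhd ℂ φ rightHalfPlane) :
    CompositionIsAutomorphism (hmaps.restrict φ rightHalfPlane rightHalfPlane) ↔
      ∃ τ : ℝ, ∀ s ∈ rightHalfPlane, φ s = s + Complex.I * (τ : ℂ) := by
  refine ⟨CompositionIsAutomorphism.exists_translation hmaps hφ, ?_⟩
  rintro ⟨τ, hτ⟩
  exact compositionIsAutomorphism_of_translation (τ := τ) fun s => hτ s s.2
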